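/- Let $(R_0,\mathfrak m)$ be an Artinian local equicharacteristic ring (i.e. $R_0$ and $R_0/\mathfrak m$ have the same characteristic) with infinite residue field $k=R_0/\mathfrak m$; write $\lambda$ for the length of $R_0$-modules. Let $b\ge 1$ and $d\ge 1$ be integers, let $R=R_0[X_1,\dots,X_b]$ with its standard grading, and let $R_n$ be its degree $n$ part. Then $R_0$ contains a coefficient field, i.e. a subfield mapped isomorphically onto $k$ by $R_0\to R_0/\mathfrak m$. Fix any coefficient field, denote it again by $k$, and let $R_1\cap k^b=\{a_1X_1+\dots+a_bX_b : a_i\in k\}$, identified with $k^b$. For every $R_0$-submodule $V\subseteq R_d$: (i) The set $$U_R(d,V)=\{h\in R_1\cap k^b : \lambda(V+hR_{d-1}) \text{ is maximal}\}$$ is Zariski-open in $R_1\cap k^b$ (maximality is among all elements of $R_1\cap k^b$). (ii) Let $\lambda(R_d/V)=\binom{d+b-1}{b-1}q+r$ with integers $q\ge 0$ and $0\le r<\binom{d+b-1}{b-1}$. For every $h\in U_R(d,V)$, put $\overline R=R/(h)$ and $\overline V=(V+hR_{d-1})/hR_{d-1}\subseteq \overline R_d$. Then $$\lambda(\overline R_d/\overline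 V)\le \binom{d+b-2}{b-2}q+(r_d)^-.$$ Here $\binom{n}{j}=0$ for $j<0$ or $n<j$, and $(0_d)^-=0$; for $n\ge 1$, $(n_d)^-=\binom{k_d-1}{d}+\binom{k_{d-1}-1}{d-1}+\dots+\binom{k_\delta-1}{\delta}$, where $n=\binom{k_d}{d}+\binom{k_{d-1}}{d-1}+\dots+\binom{k_\delta}{\delta}$ with $k_d>k_{d-1}>\dots>k_\delta\ge\delta\ge1$ is the unique $d$-binomial expansion of $n$. -/

import Mathlib

open MvPolynomial IsLocalRing

noncomputable section

namespace GreenRestriction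

/-! ### Combinatorics of binomial expansions -/

/-- `n = ∑_{i=δ}^{d} C(k_i, i)` with `k_d > ⋯ > k_δ ≥ δ ≥ 1` (and `δ ≤ d`). Only the values `k i`
with `δ ≤ i ≤ d` matter. -/
structure IsBinomialExpansion (d n δ : ℕ) (k : ℕ → ℕ) : Prop where
  one_le : 1 ≤ δ
  le_deg : δ ≤ d
  le_last : δ ≤ k δ
  strict : ∀ i, δ ≤ i → i < d → k i < k (i + 1)
  sum_eq : n = ∑ i ∈ Finset.Icc δ d, (k i).choose i

open Classical in
/-- `(n_d)^- = ∑_{i=δ}^{d} C(k_i - 1, i)`, where `n = ∑_{i=δ}^{d} C(k_i, i)` is the (unique)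
`d`-binomial expansion of `n`. The number `0` has no expansion, and `(0_d)^- = 0`. -/
def lowerMinus (d n : ℕ) : ℕ :=
  if h : ∃ e : ℕ × (ℕ → ℕ), IsBinomialExpansion d n e.1 e.2 then
    ∑ i ∈ Finset.Icc h.choose.1 d, (h.choose.2 i - 1).choose i
  else 0

/-- The binomial coefficient `C(n, j)` for `n ∈ ℕ`, `j ∈ ℤ`, which is `0` for `j < 0`. -/
def binom (n : ℕ) (j : ℤ) : ℕ := if 0 ≤ j then n.choose j.toNat else 0

/-! ### Equicharacteristic local rings and coefficient fields -/

/-- A local ring is equicharacteristic if it has the same characteristic as its residue field. -/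
def IsEquicharacteristic (R₀ : Type*) [CommRing R₀] [IsLocalRing R₀] : Prop :=
  ringChar R₀ = ringChar (ResidueField R₀)

/-- A coefficient field of the local ring `R₀` is a subfield which the residue map sends
isomorphically onto the residue field `k`. It is given here by the corresponding embedding
`ι : k → R₀`, that is, by a ring homomorphism which is a section of the residue map; the subfield
is the range of `ι`. -/
def IsCoefficientField {R₀ : Type*} [CommRing R₀] [IsLocalRing R₀]
    (ι : ResidueField R₀ →+* R₀) : Prop :=
  (residue R₀).comp ι = RingHom.id (ResidueField R₀)

/-- A subset of affine space `k^b` is Zariski-open if its complement is the set of common zeros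
of a set (equivalently, an ideal) of polynomials. -/
def IsZariskiOpen {k : Type*} [Field k] {b : ℕ} (U : Set (Fin b → k)) : Prop :=
  ∃ I : Ideal (MvPolynomial (Fin b) k), Uᶜ = zeroLocus k I

section Graded

variable {R₀ : Type*} [CommRing R₀] {b : ℕ}

/-- The degree `d` part `R_d` of `R = R₀[X_1, …, X_b]`. -/
abbrev Rdeg (R₀ : Type*) [CommRing R₀] (b d : ℕ) : Submodule R₀ (MvPolynomial (Fin b) R₀) :=
  homogeneousSubmodule (Fin b) R₀ d

/-- The length `λ(M / N)` of the quotient of a submodule `M` by a submodule `N`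
(used for `N ⊆ M` only). -/
def quotLength {E : Type*} [AddCommGroup E] [Module R₀ E] (M N : Submodule R₀ E) : ℕ∞ :=
  Module.length R₀ (M ⧸ N.submoduleOf M)

/-- `V + h R_{d-1}`. -/
def addMul (d : ℕ) (V : Submodule R₀ (MvPolynomial (Fin b) R₀)) (h : MvPolynomial (Fin b) R₀) :
    Submodule R₀ (MvPolynomial (Fin b) R₀) :=
  V ⊔ (Rdeg R₀ b (d - 1)).map (LinearMap.mulLeft R₀ h)

/-- The degree `d` part of the graded ring `R / (h)`: the image of `R_d`. -/
def quotDeg (d : ℕ) (h : MvPolynomial (Fin b) R₀) :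
    Submodule R₀ (MvPolynomial (Fin b) R₀ ⧸ Ideal.span {h}) :=
  (Rdeg R₀ b d).map (Ideal.Quotient.mkₐ R₀ (Ideal.span {h})).toLinearMap

/-- The image `(V + h R_{d-1}) / h R_{d-1}` of `V` in `R / (h)`. -/
def quotSub (d : ℕ) (V : Submodule R₀ (MvPolynomial (Fin b) R₀)) (h : MvPolynomial (Fin b) R₀) :
    Submodule R₀ (MvPolynomial (Fin b) R₀ ⧸ Ideal.span {h}) :=
  (addMul d V h).map (Ideal.Quotient.mkₐ R₀ (Ideal.span {h})).toLinearMap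

end Graded

section LinearForms

variable {R₀ : Type*} [CommRing R₀] [IsLocalRing R₀] {b : ℕ}

/-- The linear form `a_1 X_1 + ⋯ + a_b X_b` of `R` with coefficients in the coefficient field. -/
def linForm (ι : ResidueField R₀ →+* R₀) (a : Fin b → ResidueField R₀) :
    MvPolynomial (Fin b) R₀ :=
  ∑ i, C (ι (a i)) * X i

/-- `U_R(d, V)`: the linear forms `h` with coefficients in the coefficient field for which the
length of `V + h R_{d-1}` is maximal, as a subset of `k^b`. -/
def goodForms (ι : ResidueField R₀ →+* R₀) (d : ℕ)
    (V : Submodule R₀ (MvPolynomial (Fin b) R₀)) : Set (Fin b → ResidueField R₀) :=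
  {a | ∀ a' : Fin b → ResidueField R₀,
    Module.length R₀ (addMul d V (linForm ι a')) ≤ Module.length R₀ (addMul d V (linForm ι a))}

end LinearForms

end GreenRestriction

end

/-! Over a coefficient field k, the length of an R₀-module of finite length is its k-dimension
(`length_eq_length_of_isFiniteLength`), so both claims become linear algebra over k. Openness holds
because linear independence is detected by a determinant that is polynomial in the coefficients of
the linear form (`IsPolyFamily.isZariskiLSC`).

The bound is Green's restriction theorem. Its proof uses only finite-dimensional spaces P_i such
that linear forms map P_i into P_{i+1} and generate it. Choose linear forms g, h generic for V ⊆
P_{d+1}; put c = codim V and e = codim(V + gP_d) = codim(V + hP_d). Multiplication by h splits e as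
codim(V + gP_d + hP_d) plus the codimension in P_d of (V + gP_d : h). That colon space contains (V :
h) + gP_{d-1}, and (V : h) has codimension c - e. Write f_{B,d} for the bound `greenPer B d`.
Induction on the number of variables for the first term and on the degree for the second gives e ≤
f_{B,d+1}(e) + f_{B+1,d}(c - e), and `le_greenPer_of_le_add` deduces e ≤ f_{B+1,d+1}(c).

Replacing (n_d)^- by the monomial count `green` turns binomial expansions into a simple recursion.
Its periodic extension accounts for the quotient q, since R₀ may have length greater than 1.

Coefficient fields come from formal smoothness in characteristic 0, and from a maximal subring
meeting the kernel trivially in characteristic p. -/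

namespace GreenRestriction

open Module

/-! ### Combinatorics of the bounding function -/

/-- The number of monomials of degree `d` in `B + 1` variables. -/
def monoms (B d : ℕ) : ℕ := (B + d).choose d

/-- The number of monomials of degree `d` in `B` variables, which is `1` for `d = 0`. -/
def restrMonoms (B d : ℕ) : ℕ := (B + d - 1).choose d

/-- Among the first `n` monomials of degree `d` in `B + 1` variables, in the order which compares
the exponents of the largest variables first, the number of those which do not involve the
smallest variable. (All monomials are counted if `d = 0`.) -/
def green : ℕ → ℕ → ℕ → ℕ
  | _, 0, n => n
  | 0, _ + 1, _ => 0
  | B + 1, d + 1, n =>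
    if n < monoms B (d + 1) then green B (d + 1) n
    else restrMonoms B (d + 1) + green (B + 1) d (n - monoms B (d + 1))
termination_by B d _ => B + d

lemma monoms_succ_succ (B d : ℕ) :
    monoms (B + 1) (d + 1) = monoms B (d + 1) + monoms (B + 1) d := by
  unfold monoms
  rw [show B + 1 + (d + 1) = (B + d + 1) + 1 by ring, Nat.choose_succ_succ,
    show B + (d + 1) = B + d + 1 by ring, show B + 1 + d = B + d + 1 by ring, add_comm]

lemma monoms_zero_right (B : ℕ) : monoms B 0 = 1 := by simp [monoms]

lemma monoms_zero_left (d : ℕ) : monoms 0 d = 1 := by simp [monoms]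

lemma monoms_pos (B d : ℕ) : 0 < monoms B d := Nat.choose_pos (by omega)

lemma restrMonoms_succ (B d : ℕ) : restrMonoms (B + 1) d = monoms B d := by
  simp [monoms, restrMonoms, show B + 1 + d - 1 = B + d by omega]

lemma restrMonoms_zero_left (d : ℕ) : restrMonoms 0 (d + 1) = 0 := by simp [restrMonoms]

lemma monoms_eq (B d : ℕ) : monoms B (d + 1) = restrMonoms B (d + 1) + monoms B d := by
  rcases B with _ | B
  · simp [monoms_zero_left, restrMonoms_zero_left]
  · rw [restrMonoms_succ, monoms_succ_succ]

lemma green_zero_right (B n : ℕ) : green B 0 n = n := by simp [green]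

lemma green_zero_left (d n : ℕ) : green 0 (d + 1) n = 0 := by simp [green]

lemma green_succ_succ (B d n : ℕ) : green (B + 1) (d + 1) n =
    if n < monoms B (d + 1) then green B (d + 1) n
    else restrMonoms B (d + 1) + green (B + 1) d (n - monoms B (d + 1)) := by
  rw [green]

lemma green_zero (B d : ℕ) : green B d 0 = 0 := by
  induction B with
  | zero => cases d <;> simp [green]
  | succ B ih =>
    cases d with
    | zero => simp [green]
    | succ d => rw [green_succ_succ, if_pos (monoms_pos _ _), ih]

lemma green_monoms (B d : ℕ) : green B d (monoms B d) = restrMonoms B d := by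
  induction d generalizing B with
  | zero => simp [green, monoms, restrMonoms]
  | succ d ih =>
    cases B with
    | zero => simp [green, restrMonoms]
    | succ B =>
      rw [green_succ_succ, if_neg (by rw [monoms_succ_succ]; omega), monoms_succ_succ,
        Nat.add_sub_cancel_left, ih, restrMonoms_succ, restrMonoms_succ, monoms_eq]

/-- The two branches of the recursion agree at the boundary `n = monoms B (d + 1)`, so later case
splits may put it on either side. -/
lemma green_left {B d n : ℕ} (h : n ≤ monoms B (d + 1)) :
    green (B + 1) (d + 1) n = green B (d + 1) n := by
  rw [green_succ_succ]
  split_ifs with h'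
  · rfl
  · obtain rfl : n = monoms B (d + 1) := by omega
    rw [Nat.sub_self, green_zero, green_monoms, add_zero]

lemma green_right {B d n : ℕ} (h : monoms B (d + 1) ≤ n) :
    green (B + 1) (d + 1) n =
      restrMonoms B (d + 1) + green (B + 1) d (n - monoms B (d + 1)) := by
  rw [green_succ_succ, if_neg (by omega)]

lemma green_step (B d n : ℕ) :
    green B d n ≤ green B d (n + 1) ∧ green B d (n + 1) ≤ green B d n + 1 := by
  induction d generalizing B n with
  | zero => simp [green]
  | succ d ihd =>
    induction B generalizing n with
    | zero => simp [green]
    | succ B ih =>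
      rcases lt_or_ge n (monoms B (d + 1)) with h | h
      · rw [green_left h.le, green_left (by omega)]
        exact ih n
      · rw [green_right h, green_right (by omega), Nat.sub_add_comm h]
        have := ihd (B + 1) (n - monoms B (d + 1))
        omega

lemma green_mono (B d : ℕ) : Monotone (green B d) :=
  monotone_nat_of_le_succ fun n => (green_step B d n).1

lemma green_add_le (B d n m : ℕ) : green B d (n + m) ≤ green B d n + m := by
  induction m with
  | zero => simp
  | succ m ih =>
    have := (green_step B d (n + m)).2
    rw [← add_assoc]
    omega

lemma green_le (B d n : ℕ) : green B d n ≤ n := by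
  have := green_add_le B d 0 n
  simpa [green_zero] using this

lemma green_one (B d : ℕ) : green B (d + 1) 1 = 0 := by
  induction B with
  | zero => simp [green]
  | succ B ih => rw [green_left (monoms_pos _ _), ih]

lemma green_lt (B d : ℕ) {n : ℕ} (hn : 0 < n) : green B (d + 1) n < n := by
  obtain ⟨m, rfl⟩ : ∃ m, n = 1 + m := ⟨n - 1, by omega⟩
  have := green_add_le B (d + 1) 1 m
  rw [green_one] at this
  omega

lemma green_le_restrMonoms {B d n : ℕ} (h : n ≤ monoms B d) : green B d n ≤ restrMonoms B d :=
  green_monoms B d ▸ green_mono B d h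

/-- A prefix has at most `monoms B d` uncounted elements. -/
lemma le_green_add_monoms {B d n : ℕ} (h : n ≤ monoms B (d + 1)) :
    n ≤ green B (d + 1) n + monoms B d := by
  have h1 := green_add_le B (d + 1) n (monoms B (d + 1) - n)
  rw [Nat.add_sub_cancel' h, green_monoms] at h1
  have := monoms_eq B d
  omega

lemma green_left' {B d n : ℕ} (h : n ≤ monoms B d) : green (B + 1) d n = green B d n := by
  cases d with
  | zero => simp [green]
  | succ d => exact green_left h

/-- The combinatorial inequality behind Green's theorem, within one period. -/
lemma le_green_add (B d : ℕ) : ∀ e x : ℕ, e ≤ monoms B (d + 1) → x ≤ monoms (B + 1) d →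
    e ≤ green B (d + 1) e + green (B + 1) d x → e ≤ green (B + 1) (d + 1) (e + x) := by
  induction d generalizing B with
  | zero =>
    intro e x he hx h
    rw [monoms_zero_right] at hx
    rw [green_zero_right] at h
    rcases Nat.eq_zero_or_pos e with rfl | hpos
    · simp
    · have := green_lt B 0 hpos
      obtain rfl : x = 1 := by omega
      have hm := monoms_eq B 0
      rw [monoms_zero_right] at hm
      rcases he.eq_or_lt with rfl | hlt
      · rw [green_right (by omega), green_zero_right]
        omega
      · rw [green_left (by omega)]
        have h1 := green_add_le B 1 (e + 1) (monoms B 1 - (e + 1))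
        rw [show e + 1 + (monoms B 1 - (e + 1)) = monoms B 1 by simp only [zero_add] at *; omega,
          green_monoms] at h1
        have h2 := restrMonoms_succ B (0 + 1)
        have h3 := green_le B 1 e
        simp only [zero_add] at *
        omega
  | succ d ihd =>
    induction B with
    | zero =>
      intro e x he hx h
      rw [monoms_zero_left] at he
      rw [green_zero_left] at h
      rcases Nat.eq_zero_or_pos e with rfl | hpos
      · simp
      obtain rfl : e = 1 := by omega
      have hm := monoms_succ_succ 0 d
      rw [monoms_zero_left] at hm
      have hx' : monoms 0 (d + 1) ≤ x := by
        by_contra hx'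
        rw [green_left (by omega), green_zero_left] at h
        omega
      rw [green_right (by rw [monoms_zero_left]; omega), restrMonoms_zero_left, monoms_zero_left,
        Nat.add_sub_cancel_left]
      omega
    | succ B ihB =>
      intro e x he hx h
      have hu := monoms_succ_succ B (d + 1)
      have hz := monoms_eq B (d + 1)
      have hv := monoms_succ_succ (B + 1) d
      have hzu := monoms_eq (B + 1) (d + 1)
      have hru := restrMonoms_succ B (d + 1 + 1)
      have hrv := restrMonoms_succ (B + 1) (d + 1)
      have hrv' := restrMonoms_succ B (d + 1)
      -- the number of uncounted elements in a prefix which is not contained in the first block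
      have key : ∀ e', 0 < e' → x ≤ monoms (B + 1) (d + 1) →
          e = monoms B (d + 1 + 1) + e' → False := by
        rintro e' he' hx' rfl
        rw [green_right (by omega), Nat.add_sub_cancel_left, green_left' hx'] at h
        have h1 := green_lt (B + 1) d he'
        have h2 := green_le_restrMonoms hx'
        omega
      rcases le_or_gt (e + x) (monoms (B + 1) (d + 1 + 1)) with hr | hr
      · rw [green_left hr]
        rcases le_or_gt x (monoms (B + 1) (d + 1)) with hx' | hx'
        · rcases le_or_gt e (monoms B (d + 1 + 1)) with he' | he'
          · refine ihB e x he' hx' ?_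
            rwa [green_left he', green_left' hx'] at h
          · exact (key (e - monoms B (d + 1 + 1)) (by omega) hx' (by omega)).elim
        · have := le_green_add_monoms hr
          omega
      · rw [green_right hr.le]
        rcases le_or_gt e (monoms B (d + 1 + 1)) with he' | he'
        · omega
        · obtain ⟨e', rfl⟩ : ∃ e', e = monoms B (d + 1 + 1) + e' :=
            ⟨e - monoms B (d + 1 + 1), by omega⟩
          rcases le_or_gt x (monoms (B + 1) (d + 1)) with hx' | hx'
          · exact (key e' (by omega) hx' rfl).elim
          · obtain ⟨x', rfl⟩ : ∃ x', x = monoms (B + 1) (d + 1) + x' :=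
              ⟨x - monoms (B + 1) (d + 1), by omega⟩
            rw [green_right (B := B) (by omega), green_right (B := B + 1) (by omega),
              Nat.add_sub_cancel_left, Nat.add_sub_cancel_left] at h
            have := ihd (B + 1) e' x' (by omega) (by omega) (by omega)
            have hs : monoms B (d + 1 + 1) + e' + (monoms (B + 1) (d + 1) + x') -
              monoms (B + 1) (d + 1 + 1) = e' + x' := by omega
            rw [hs]
            omega

/-- The periodic extension of `green`. -/
def greenPer (B d c : ℕ) : ℕ :=
  restrMonoms B d * (c / monoms B d) + green B d (c % monoms B d)

lemma greenPer_mul_add {B d q r : ℕ} (hr : r < monoms B d) :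
    greenPer B d (monoms B d * q + r) = restrMonoms B d * q + green B d r := by
  unfold greenPer
  rw [Nat.mul_add_div (monoms_pos B d), Nat.mul_add_mod, Nat.div_eq_of_lt hr,
    Nat.mod_eq_of_lt hr, add_zero]

lemma greenPer_mul_add' {B d q r : ℕ} (hr : r ≤ monoms B d) :
    greenPer B d (monoms B d * q + r) = restrMonoms B d * q + green B d r := by
  rcases hr.eq_or_lt with rfl | hr
  · have := greenPer_mul_add (q := q + 1) (monoms_pos B d)
    rw [green_zero, add_zero] at this
    rw [green_monoms]
    exact this
  · exact greenPer_mul_add hr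

lemma greenPer_zero_right (B c : ℕ) : greenPer B 0 c = c := by
  simp [greenPer, monoms_zero_right, restrMonoms, Nat.mod_one, green_zero_right]

lemma greenPer_mono (B d : ℕ) : Monotone (greenPer B d) := by
  refine monotone_nat_of_le_succ fun n => ?_
  have hn := Nat.div_add_mod n (monoms B d)
  have hlt := Nat.mod_lt n (monoms_pos B d)
  have h1 := greenPer_mul_add' (B := B) (d := d) (q := n / monoms B d) hlt.le
  have h2 := greenPer_mul_add' (B := B) (d := d) (q := n / monoms B d)
    (r := n % monoms B d + 1) (by omega)
  rw [← add_assoc, hn] at h2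
  rw [hn] at h1
  rw [h1, h2]
  exact Nat.add_le_add_left (green_mono B d (by omega)) _

/-- The combinatorial inequality behind Green's theorem. -/
lemma le_greenPer_of_le_add {B d c e : ℕ} (hec : e ≤ c)
    (h : e ≤ greenPer B (d + 1) e + greenPer (B + 1) d (c - e)) :
    e ≤ greenPer (B + 1) (d + 1) c := by
  obtain ⟨x, rfl⟩ := Nat.exists_eq_add_of_le hec
  rw [Nat.add_sub_cancel_left] at h
  have hw := monoms_succ_succ B d
  have hz := monoms_eq B d
  have hrw := restrMonoms_succ B (d + 1)
  have hrv := restrMonoms_succ B d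
  have hzpos := monoms_pos B d
  obtain ⟨q₁, e', he', rfl⟩ : ∃ q e', e' < monoms B (d + 1) ∧ e = monoms B (d + 1) * q + e' :=
    ⟨_, _, Nat.mod_lt e (monoms_pos _ _), (Nat.div_add_mod _ _).symm⟩
  obtain ⟨q₂, x', hx', rfl⟩ : ∃ q x', x' < monoms (B + 1) d ∧ x = monoms (B + 1) d * q + x' :=
    ⟨_, _, Nat.mod_lt x (monoms_pos _ _), (Nat.div_add_mod _ _).symm⟩
  rw [greenPer_mul_add he', greenPer_mul_add hx', hrv] at h
  have hx'le := green_le_restrMonoms hx'.le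
  -- If `q₁ < q₂`, then `c` exceeds `q₁` periods by enough for a crude estimate. If they are equal,
  -- the one-period inequality applies. If `q₁ > q₂`, the hypothesis forces `q₁ = q₂ + 1` and `e' =
  -- 0`, and the extra period of `e` is treated as a full remainder.
  rcases lt_trichotomy q₁ q₂ with hq | rfl | hq
  · obtain ⟨j, rfl⟩ := Nat.exists_eq_add_of_lt hq
    have h1 : monoms (B + 1) (d + 1) * q₁ + (e' + monoms (B + 1) d) ≤
        monoms B (d + 1) * q₁ + e' + (monoms (B + 1) d * (q₁ + j + 1) + x') := by
      rw [hw]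
      nlinarith [Nat.zero_le (monoms (B + 1) d * j)]
    refine le_trans ?_ (greenPer_mono _ _ h1)
    rw [greenPer_mul_add (by omega), hrw]
    have := le_green_add_monoms (B := B + 1) (d := d) (n := e' + monoms (B + 1) d) (by omega)
    omega
  · rw [hz] at h
    have := le_green_add B d e' x' he'.le hx'.le (by nlinarith)
    rw [show monoms B (d + 1) * q₁ + e' + (monoms (B + 1) d * q₁ + x') =
      monoms (B + 1) (d + 1) * q₁ + (e' + x') by rw [hw]; ring,
      greenPer_mul_add (by omega), hrw]
    omega
  · obtain ⟨j, rfl⟩ := Nat.exists_eq_add_of_lt hq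
    rw [hz] at h
    have hle := green_le B (d + 1) e'
    have hj : j = 0 := by
      by_contra hj
      have : monoms B d * 1 ≤ monoms B d * j := Nat.mul_le_mul_left _ (by omega)
      nlinarith
    subst hj
    have h0 : e' = 0 := by
      by_contra h0
      have := green_lt B d (Nat.pos_of_ne_zero h0)
      nlinarith
    subst h0
    rw [green_zero] at h
    have := le_green_add B d (monoms B (d + 1)) x' le_rfl hx'.le (by
      rw [green_monoms]; nlinarith)
    rw [show monoms B (d + 1) * (q₂ + 0 + 1) + 0 + (monoms (B + 1) d * q₂ + x') =
      monoms (B + 1) (d + 1) * q₂ + (monoms B (d + 1) + x') by rw [hw]; ring,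
      greenPer_mul_add (by omega), hrw]
    nlinarith

/-! ### Comparison with binomial expansions -/

namespace IsBinomialExpansion

variable {d n δ : ℕ} {k : ℕ → ℕ}

lemma le_apply (h : IsBinomialExpansion d n δ k) : ∀ i, δ ≤ i → i ≤ d → i ≤ k i := by
  intro i hi
  induction i, hi using Nat.le_induction with
  | base => exact fun _ => h.le_last
  | succ i hi ih =>
    intro hd
    have := h.strict i hi (by omega)
    have := ih (by omega)
    omega

lemma restrict (h : IsBinomialExpansion (d + 1) n δ k) (hδ : δ ≤ d) :
    IsBinomialExpansion d (n - (k (d + 1)).choose (d + 1)) δ k where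
  one_le := h.one_le
  le_deg := hδ
  le_last := h.le_last
  strict i hi hid := h.strict i hi (by omega)
  sum_eq := by
    rw [h.sum_eq, Finset.sum_Icc_succ_top (by omega), Nat.add_sub_cancel]

lemma choose_le (h : IsBinomialExpansion d n δ k) : (k d).choose d ≤ n := by
  rw [h.sum_eq]
  exact Finset.single_le_sum (f := fun i => (k i).choose i) (fun _ _ => Nat.zero_le _)
    (Finset.mem_Icc.2 ⟨h.le_deg, le_rfl⟩)

lemma pos (h : IsBinomialExpansion d n δ k) : 0 < n :=
  (Nat.choose_pos (h.le_apply d h.le_deg le_rfl)).trans_le h.choose_le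

lemma lt_choose (h : IsBinomialExpansion d n δ k) : n < (k d + 1).choose d := by
  induction d generalizing n with
  | zero => have := h.one_le; have := h.le_deg; omega
  | succ d ih =>
    have h1 := h.choose_le
    rw [Nat.choose_succ_succ']
    rcases Nat.lt_or_ge d δ with hδ | hδ
    · obtain rfl : δ = d + 1 := by have := h.le_deg; omega
      have hs := h.sum_eq
      rw [Finset.Icc_self, Finset.sum_singleton] at hs
      have : 0 < (k (d + 1)).choose d := Nat.choose_pos (by have := h.le_last; omega)
      omega
    · have h2 := ih (h.restrict hδ)
      have h3 : (k d + 1).choose d ≤ (k (d + 1)).choose d :=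
        Nat.choose_le_choose d (h.strict d hδ (by omega))
      omega

/-- If `monoms B d ≤ n < monoms (B + 1) d`, the leading index `k d` must be `B + d`; removing its
term is exactly the second branch of the recursion for `green`. As this holds for every expansion,
the one selected in `lowerMinus` does not matter. -/
lemma sum_eq_green (h : IsBinomialExpansion d n δ k) {B : ℕ} (hn : n < monoms B d) :
    ∑ i ∈ Finset.Icc δ d, (k i - 1).choose i = green B d n := by
  induction d generalizing n B with
  | zero => have := h.one_le; have := h.le_deg; omega
  | succ d ihd =>
    induction B with
    | zero => rw [monoms_zero_left] at hn; have := h.pos; omega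
    | succ B ihB =>
      rcases lt_or_ge n (monoms B (d + 1)) with hlt | hge
      · rw [green_left hlt.le]
        exact ihB hlt
      · have hk : k (d + 1) = B + d + 1 := by
          apply le_antisymm
          · by_contra hc
            have h1 : (B + 1 + (d + 1)).choose (d + 1) ≤ (k (d + 1)).choose (d + 1) :=
              Nat.choose_le_choose _ (by omega)
            have h2 := h.choose_le
            unfold monoms at hn
            omega
          · by_contra hc
            have h1 : (k (d + 1) + 1).choose (d + 1) ≤ (B + (d + 1)).choose (d + 1) :=
              Nat.choose_le_choose _ (by omega)
            have h2 := h.lt_choose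
            unfold monoms at hge
            omega
        have hm : (k (d + 1)).choose (d + 1) = monoms B (d + 1) := by rw [hk]; rfl
        have hr : (k (d + 1) - 1).choose (d + 1) = restrMonoms B (d + 1) := by rw [hk]; rfl
        rw [green_right hge, Finset.sum_Icc_succ_top h.le_deg, hr, add_comm]
        congr 1
        rcases Nat.lt_or_ge d δ with hδ | hδ
        · obtain rfl : δ = d + 1 := by have := h.le_deg; omega
          have hs := h.sum_eq
          rw [Finset.Icc_self, Finset.sum_singleton, hm] at hs
          rw [hs, Nat.sub_self, green_zero, Finset.Icc_eq_empty (by omega), Finset.sum_empty]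
        · rw [← hm]
          refine ihd (h.restrict hδ) ?_
          rw [hm]
          have := monoms_succ_succ B d
          omega

end IsBinomialExpansion

/-- Greedy choice: the largest possible leading binomial leaves a remainder too small to violate
strict monotonicity. -/
lemma exists_isBinomialExpansion {B d n : ℕ} (hn : 0 < n) (hlt : n < monoms B (d + 1)) :
    ∃ (δ : ℕ) (k : ℕ → ℕ), IsBinomialExpansion (d + 1) n δ k := by
  induction d generalizing B n with
  | zero =>
    exact ⟨1, fun _ => n, le_rfl, le_rfl, hn, fun i _ _ => by omega, by simp⟩
  | succ d ihd =>
    induction B with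
    | zero => rw [monoms_zero_left] at hlt; omega
    | succ B ihB =>
      rcases lt_or_ge n (monoms B (d + 1 + 1)) with h | h
      · exact ihB h
      have hm := monoms_succ_succ B (d + 1)
      rcases h.eq_or_lt with h | h
      · refine ⟨d + 2, fun _ => B + (d + 2), by simp, le_rfl, by simp, fun i _ _ => by omega, ?_⟩
        rw [Finset.Icc_self, Finset.sum_singleton, ← h]
        rfl
      · obtain ⟨δ, k, he⟩ := ihd (B := B + 1) (n := n - monoms B (d + 1 + 1)) (by omega) (by omega)
        have hkd : k (d + 1) < B + (d + 2) := by
          by_contra hc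
          have h1 : (B + 1 + (d + 1)).choose (d + 1) ≤ (k (d + 1)).choose (d + 1) :=
            Nat.choose_le_choose _ (by omega)
          have h2 := he.choose_le
          unfold monoms at *
          omega
        have hδ := he.le_deg
        refine ⟨δ, Function.update k (d + 2) (B + (d + 2)), he.one_le, ?_, ?_, ?_, ?_⟩
        · omega
        · rw [Function.update_of_ne (by omega)]
          exact he.le_last
        · intro i hi hid
          rw [Function.update_of_ne (by omega)]
          rcases Nat.lt_or_ge i (d + 1) with h' | h'
          · rw [Function.update_of_ne (by omega)]
            exact he.strict i hi h'
          · obtain rfl : i = d + 1 := by omega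
            rw [Function.update_self]
            exact hkd
        · rw [Finset.sum_Icc_succ_top (by omega), Function.update_self]
          have hs : ∑ i ∈ Finset.Icc δ (d + 1), (Function.update k (d + 2) (B + (d + 2)) i).choose i
              = n - monoms B (d + 1 + 1) := by
            rw [he.sum_eq]
            refine Finset.sum_congr rfl fun i hi => ?_
            rw [Function.update_of_ne (by have := (Finset.mem_Icc.1 hi).2; omega)]
          rw [hs]
          unfold monoms at *
          change n = _ + (B + (d + 1 + 1)).choose (d + 1 + 1)
          omega

lemma lowerMinus_eq_green {B d n : ℕ} (hlt : n < monoms B (d + 1)) :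
    lowerMinus (d + 1) n = green B (d + 1) n := by
  unfold lowerMinus
  split_ifs with h
  · exact h.choose_spec.sum_eq_green hlt
  · rcases Nat.eq_zero_or_pos n with rfl | hn
    · rw [green_zero]
    · obtain ⟨δ, k, he⟩ := exists_isBinomialExpansion hn hlt
      exact (h ⟨(δ, k), he⟩).elim

/-! ### Semicontinuity of dimension in polynomial families -/

section Semicontinuity

variable {k : Type*} [Field k] {σ : Type*} {F : Type*} [AddCommGroup F] [Module k F]

/-- A function on affine space given by a polynomial. -/
def IsPolyFun (f : (σ → k) → k) : Prop := ∃ p : MvPolynomial σ k, ∀ x, eval x p = f x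

/-- A vector valued function on affine space which is polynomial in all coordinates. -/
def IsPolySection (w : (σ → k) → F) : Prop := ∀ ψ : Dual k F, IsPolyFun fun x => ψ (w x)

/-- A family of subspaces such that every element of a member of the family extends to
a polynomial section. -/
def IsPolyFamily (D : (σ → k) → Submodule k F) : Prop :=
  ∀ x, ∀ v ∈ D x, ∃ w : (σ → k) → F, IsPolySection w ∧ w x = v ∧ ∀ y, w y ∈ D y

/-- Lower semicontinuity for the Zariski topology. -/
def IsZariskiLSC (f : (σ → k) → ℕ) : Prop :=
  ∀ x, ∃ p : MvPolynomial σ k, eval x p ≠ 0 ∧ ∀ y, eval y p ≠ 0 → f x ≤ f y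

lemma isPolySection_const (v : F) : IsPolySection fun _ : σ → k => v :=
  fun ψ => ⟨C (ψ v), fun x => by simp⟩

lemma IsPolySection.add {v w : (σ → k) → F} (hv : IsPolySection v) (hw : IsPolySection w) :
    IsPolySection fun x => v x + w x := by
  intro ψ
  obtain ⟨p, hp⟩ := hv ψ
  obtain ⟨q, hq⟩ := hw ψ
  exact ⟨p + q, fun x => by simp [hp, hq]⟩

lemma isPolySection_const_family (V : Submodule k F) : IsPolyFamily fun _ : σ → k => V :=
  fun _ v hv => ⟨fun _ => v, isPolySection_const v, rfl, fun _ => hv⟩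

lemma IsPolyFamily.sup {D E : (σ → k) → Submodule k F} (hD : IsPolyFamily D)
    (hE : IsPolyFamily E) : IsPolyFamily fun x => D x ⊔ E x := by
  intro x v hv
  obtain ⟨a, ha, b, hb, rfl⟩ := Submodule.mem_sup.1 hv
  obtain ⟨u, hu, rfl, hu'⟩ := hD x a ha
  obtain ⟨w, hw, rfl, hw'⟩ := hE x b hb
  exact ⟨fun x => u x + w x, hu.add hw, rfl, fun y => Submodule.add_mem_sup (hu' y) (hw' y)⟩

lemma IsPolySection.linear_mul [Fintype σ] [DecidableEq σ] {S : Type*} [CommRing S] [Algebra k S]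
    (L : (σ → k) →ₗ[k] S) {w : (σ → k) → S} (hw : IsPolySection w) :
    IsPolySection fun x => L x * w x := by
  intro ψ
  choose p hp using fun i : σ => hw (ψ ∘ₗ LinearMap.mulLeft k (L fun j => if i = j then 1 else 0))
  refine ⟨∑ i, X i * p i, fun x => ?_⟩
  change _ = ψ (L x * w x)
  rw [LinearMap.pi_apply_eq_sum_univ L x, Finset.sum_mul, map_sum, map_sum]
  refine Finset.sum_congr rfl fun i _ => ?_
  rw [map_mul, hp, eval_X, smul_mul_assoc, map_smul, smul_eq_mul]
  rfl

lemma IsPolyFamily.linear_mul [Fintype σ] [DecidableEq σ] {S : Type*} [CommRing S] [Algebra k S]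
    (L : (σ → k) →ₗ[k] S) {D : (σ → k) → Submodule k S} (hD : IsPolyFamily D) :
    IsPolyFamily fun x => (D x).map (LinearMap.mulLeft k (L x)) := by
  rintro x _ ⟨v, hv, rfl⟩
  obtain ⟨w, hw, rfl, hw'⟩ := hD x v hv
  exact ⟨fun x => L x * w x, hw.linear_mul L, rfl, fun y => ⟨w y, hw' y, rfl⟩⟩

/-- Extend a basis of `D x` to polynomial sections and read them in coordinates dual to that basis.
The determinant is 1 at `x`, and wherever it is nonzero the sections remain independent. -/
lemma IsPolyFamily.isZariskiLSC {D : (σ → k) → Submodule k F} (hD : IsPolyFamily D)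
    [∀ x, FiniteDimensional k (D x)] : IsZariskiLSC fun x => finrank k (D x) := by
  intro x
  let b := finBasis k (D x)
  choose w hw hwx hwD using fun i => hD x (b i) (b i).2
  have hli : LinearIndependent k fun i => (b i : F) :=
    b.linearIndependent.map' (D x).subtype (Submodule.ker_subtype _)
  obtain ⟨Φ, hΦ⟩ := LinearMap.exists_leftInverse_of_injective _ (LinearMap.ker_eq_bot.2
    hli.fintypeLinearCombination_injective)
  choose p hp using fun i j => hw i ((LinearMap.proj j : (Fin (finrank k (D x)) → k) →ₗ[k] k) ∘ₗ Φ)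
  have heval : ∀ y, eval y (Matrix.det (Matrix.of p)) = Matrix.det (fun i j => Φ (w i y) j) := by
    intro y
    rw [RingHom.map_det]
    congr 1
    ext i j
    simp [hp]
  refine ⟨Matrix.det (Matrix.of p), ?_, fun y hy => ?_⟩
  · rw [heval]
    have : (fun i j => Φ (w i x) j) = (1 : Matrix (Fin (finrank k (D x))) _ k) := by
      ext i j
      have := LinearMap.congr_fun hΦ (Pi.single i 1)
      simp only [LinearMap.comp_apply, Fintype.linearCombination_apply_single, one_smul,
        LinearMap.id_apply] at this
      rw [hwx, this, Matrix.one_apply, Pi.single_apply]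
      simp [eq_comm]
    rw [this, Matrix.det_one]
    exact one_ne_zero
  · rw [heval] at hy
    have h1 : LinearIndependent k fun i => Φ (w i y) :=
      Matrix.linearIndependent_rows_of_det_ne_zero hy
    have h2 : LinearIndependent k fun i => (⟨w i y, hwD i y⟩ : D y) :=
      LinearIndependent.of_comp (Φ ∘ₗ (D y).subtype) h1
    simpa using h2.fintype_card_le_finrank

lemma exists_isMax {α : Type*} [Nonempty α] {f : α → ℕ} {N : ℕ} (hf : ∀ x, f x ≤ N) :
    ∃ x, ∀ y, f y ≤ f x := by
  have hb : BddAbove (Set.range f) := ⟨N, by rintro _ ⟨x, rfl⟩; exact hf x⟩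
  obtain ⟨x, hx⟩ := Nat.sSup_mem (Set.range_nonempty f) hb
  exact ⟨x, fun y => hx ▸ le_csSup hb ⟨y, rfl⟩⟩

/-- Over an infinite field, finitely many semicontinuous functions attain their maxima
simultaneously. -/
lemma exists_forall_isMax [Infinite k] {ι : Type*} [Fintype ι] {f : ι → (σ → k) → ℕ} {N : ℕ}
    (hf : ∀ i, IsZariskiLSC (f i)) (hN : ∀ i x, f i x ≤ N) : ∃ y, ∀ i x, f i x ≤ f i y := by
  choose x hx using fun i => exists_isMax (hN i)
  choose p hp hp' using fun i => hf i (x i)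
  have hne : ∏ i, p i ≠ 0 := Finset.prod_ne_zero_iff.2 fun i _ h => hp i (by rw [h, map_zero])
  obtain ⟨y, hy⟩ : ∃ y, eval y (∏ i, p i) ≠ 0 := by
    by_contra! h
    exact hne (MvPolynomial.funext fun y => by rw [h, map_zero])
  rw [map_prod] at hy
  exact ⟨y, fun i z => (hx i z).trans (hp' i y (Finset.prod_ne_zero_iff.1 hy i (Finset.mem_univ i)))⟩

/-- Around a maximum point `x`, the polynomial given by semicontinuity is nonzero only at maximum
points, so it lies in the vanishing ideal of the complement but not in the ideal of `x`. -/
lemma IsZariskiLSC.isZariskiOpen {b : ℕ} {f : (Fin b → k) → ℕ} (hf : IsZariskiLSC f) :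
    IsZariskiOpen {x | ∀ y, f y ≤ f x} := by
  refine ⟨vanishingIdeal k {x | ∀ y, f y ≤ f x}ᶜ, ?_⟩
  refine Set.Subset.antisymm (fun x hx p hp => hp x hx) fun x hx hxU => ?_
  obtain ⟨p, hp, hp'⟩ := hf x
  refine hp (hx p fun y hy => ?_)
  by_contra hne
  exact hy fun z => (hxU z).trans (hp' y hne)

end Semicontinuity

/-! ### Green's theorem over an infinite field -/

section Bound

lemma finrank_map_add_finrank_inf_ker {k E F : Type*} [Field k] [AddCommGroup E] [Module k E]
    [AddCommGroup F] [Module k F] (f : E →ₗ[k] F) (N : Submodule k E) [FiniteDimensional k N] :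
    finrank k (N.map f) + finrank k (N ⊓ LinearMap.ker f : Submodule k E) = finrank k N := by
  rw [← LinearMap.finrank_range_add_finrank_ker (f.domRestrict N), LinearMap.range_domRestrict]
  congr 1
  rw [LinearMap.ker_domRestrict, ← Submodule.map_comap_subtype, Submodule.finrank_map_subtype_eq]

variable {k : Type*} [Field k] {S : Type*} [CommRing S] [Algebra k S] {n : ℕ}

/-- `ℓ(g) P_{d-1}`, which is `0` for `d = 0`. -/
def linMul (ℓ : (Fin n → k) →ₗ[k] S) (P : ℕ → Submodule k S) : ℕ → (Fin n → k) → Submodule k S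
  | 0, _ => ⊥
  | d + 1, g => (P d).map (LinearMap.mulLeft k (ℓ g))

/-- The elements of `N` which multiplication by `s` sends to `V`. -/
def colonIn (V N : Submodule k S) (s : S) : Submodule k S := N ⊓ V.comap (LinearMap.mulLeft k s)

/-- Rank–nullity for `N → (V + sN)/V`, whose kernel is the colon space. -/
lemma finrank_sup_map_add (V N : Submodule k S) (s : S) [FiniteDimensional k V]
    [FiniteDimensional k N] :
    finrank k (V ⊔ N.map (LinearMap.mulLeft k s) : Submodule k S) + finrank k (colonIn V N s) =
      finrank k V + finrank k N := by
  have h1 := finrank_map_add_finrank_inf_ker (V.mkQ ∘ₗ LinearMap.mulLeft k s) N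
  have h2 := finrank_map_add_finrank_inf_ker V.mkQ (V ⊔ N.map (LinearMap.mulLeft k s))
  rw [LinearMap.ker_comp, Submodule.ker_mkQ, Submodule.map_comp] at h1
  rw [Submodule.ker_mkQ, inf_eq_right.2 le_sup_left, Submodule.map_sup, Submodule.mkQ_map_self,
    bot_sup_eq] at h2
  unfold colonIn
  omega

variable {ℓ : (Fin n → k) →ₗ[k] S} {P : ℕ → Submodule k S}

instance linMul_finiteDimensional [∀ i, FiniteDimensional k (P i)] (d : ℕ) (g : Fin n → k) :
    FiniteDimensional k (linMul ℓ P d g) := by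
  cases d <;> unfold linMul <;> infer_instance

lemma isPolyFamily_linMul {σ : Type*} [Fintype σ] [DecidableEq σ]
    (T : (σ → k) →ₗ[k] (Fin n → k)) (d : ℕ) :
    IsPolyFamily fun x : σ → k => linMul ℓ P d (T x) := by
  cases d with
  | zero => exact isPolySection_const_family ⊥
  | succ d => exact (isPolySection_const_family (P d)).linear_mul (ℓ ∘ₗ T)

lemma linMul_le (hmul : ∀ i a, ∀ p ∈ P i, ℓ a * p ∈ P (i + 1)) (d : ℕ) (g : Fin n → k) :
    linMul ℓ P d g ≤ P d := by
  cases d with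
  | zero => exact bot_le
  | succ d => rintro _ ⟨p, hp, rfl⟩; exact hmul d g p hp

lemma mul_linMul (hmul : ∀ i a, ∀ p ∈ P i, ℓ a * p ∈ P (i + 1)) (d : ℕ) (g h : Fin n → k) {p : S}
    (hp : p ∈ linMul ℓ P d g) : ℓ h * p ∈ linMul ℓ P (d + 1) g := by
  cases d with
  | zero => rw [(Submodule.mem_bot k).1 hp, mul_zero]; exact zero_mem _
  | succ d =>
    obtain ⟨q, hq, rfl⟩ := hp
    exact ⟨ℓ h * q, hmul d h q hq, mul_left_comm _ _ _⟩

/-- If `V` absorbs the multiples of all linear forms in `G`, and `G` and `h` span all linear forms,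
then `V` and the multiples of `h` generate everything. -/
lemma le_sup_linMul_of_sup_eq_top (hgen : ∀ i (V : Submodule k S),
      (∀ a, ∀ p ∈ P i, ℓ a * p ∈ V) → P (i + 1) ≤ V) {d : ℕ} {V : Submodule k S}
    {G : Submodule k (Fin n → k)} (hGV : ∀ g ∈ G, linMul ℓ P (d + 1) g ≤ V) {h : Fin n → k}
    (hG : G ⊔ Submodule.span k {h} = ⊤) : P (d + 1) ≤ V ⊔ linMul ℓ P (d + 1) h := by
  refine hgen d _ fun a p hp => ?_
  obtain ⟨g, hg, z, hz, rfl⟩ := Submodule.mem_sup.1 (hG ▸ Submodule.mem_top : a ∈ G ⊔ _)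
  obtain ⟨t, rfl⟩ := Submodule.mem_span_singleton.1 hz
  rw [map_add, add_mul]
  refine Submodule.add_mem_sup (hGV g hg ⟨p, hp, rfl⟩) ?_
  rw [map_smul, smul_mul_assoc]
  exact Submodule.smul_mem _ _ ⟨p, hp, rfl⟩

lemma finrank_sup_span_singleton {G : Submodule k (Fin n → k)} {g : Fin n → k} (hg : g ∉ G) :
    finrank k (G ⊔ Submodule.span k {g} : Submodule k (Fin n → k)) = finrank k G + 1 := by
  have h0 : g ≠ 0 := fun h => hg (h ▸ G.zero_mem)
  have h1 := Submodule.finrank_sup_add_finrank_inf_eq G (Submodule.span k {g})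
  rw [finrank_span_singleton h0, (Submodule.disjoint_span_singleton.2
    (fun h => (hg h).elim) : Disjoint G (Submodule.span k {g})).eq_bot, finrank_bot] at h1
  exact h1

/-- **Green's hyperplane restriction theorem** for quotients of free modules. -/
theorem finrank_sub_finrank_sup_linMul_le [Infinite k] [hfin : ∀ i, FiniteDimensional k (P i)]
    (hmul : ∀ i a, ∀ p ∈ P i, ℓ a * p ∈ P (i + 1))
    (hgen : ∀ i (V : Submodule k S), (∀ a, ∀ p ∈ P i, ℓ a * p ∈ V) → P (i + 1) ≤ V)
    -- Forms in `G` act as zero modulo `V`, so only `B + 1` variables are effective. Restricting to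
    -- a hyperplane enlarges `G`, without changing the ambient ring.
    (d : ℕ) : ∀ (B : ℕ) (V : Submodule k S) (G : Submodule k (Fin n → k)), V ≤ P d →
      finrank k G + B + 1 = n → (∀ g ∈ G, linMul ℓ P d g ≤ V) → ∀ h,
      (∀ h', finrank k (V ⊔ linMul ℓ P d h' : Submodule k S) ≤
        finrank k (V ⊔ linMul ℓ P d h : Submodule k S)) →
      finrank k (P d) - finrank k (V ⊔ linMul ℓ P d h : Submodule k S) ≤
        greenPer B d (finrank k (P d) - finrank k V) := by
  induction d with
  | zero =>
    intro B V G _ _ _ h _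
    rw [greenPer_zero_right, linMul, sup_bot_eq]
  | succ d ihd =>
    intro B
    induction B with
    | zero =>
      intro V G hV hG hGV h hh
      have : FiniteDimensional k V := Submodule.finiteDimensional_of_le hV
      obtain ⟨g, hg⟩ : ∃ g, g ∉ G := by
        by_contra! hc
        rw [Submodule.eq_top_iff'.2 hc, finrank_top, finrank_fin_fun] at hG
        omega
      have hfull : P (d + 1) ≤ V ⊔ linMul ℓ P (d + 1) g := by
        refine le_sup_linMul_of_sup_eq_top hgen hGV (Submodule.eq_top_of_finrank_eq ?_)
        rw [finrank_sup_span_singleton hg, finrank_fin_fun]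
        exact hG
      have := Submodule.finrank_mono hfull
      have := hh g
      omega
    | succ B ihB =>
      intro V G hV hG hGV h₀ hh₀
      have : FiniteDimensional k V := Submodule.finiteDimensional_of_le hV
      let T₁ : (Fin n ⊕ Fin n → k) →ₗ[k] (Fin n → k) := LinearMap.funLeft k k Sum.inl
      let T₂ : (Fin n ⊕ Fin n → k) →ₗ[k] (Fin n → k) := LinearMap.funLeft k k Sum.inr
      obtain ⟨g, h, hg, hh, hgh, hmax⟩ : ∃ g h : Fin n → k,
          (∀ g', finrank k (V ⊔ linMul ℓ P (d + 1) g' : Submodule k S) ≤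
            finrank k (V ⊔ linMul ℓ P (d + 1) g : Submodule k S)) ∧
          (∀ h', finrank k (V ⊔ linMul ℓ P (d + 1) h' : Submodule k S) ≤
            finrank k (V ⊔ linMul ℓ P (d + 1) h : Submodule k S)) ∧
          (∀ g', finrank k
              (V ⊔ (linMul ℓ P d g').map (LinearMap.mulLeft k (ℓ h)) : Submodule k S) ≤
            finrank k
              (V ⊔ (linMul ℓ P d g).map (LinearMap.mulLeft k (ℓ h)) : Submodule k S)) ∧
          (∀ h', finrank k
              (V ⊔ linMul ℓ P (d + 1) g ⊔ linMul ℓ P (d + 1) h' : Submodule k S) ≤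
            finrank k
              (V ⊔ linMul ℓ P (d + 1) g ⊔ linMul ℓ P (d + 1) h : Submodule k S)) := by
        have hVc := isPolySection_const_family (σ := Fin n ⊕ Fin n) V
        -- Genericity is imposed on the pair `(g, h)`: four dimension functions on the space of
        -- pairs are maximized at once.
        let D : Fin 4 → (Fin n ⊕ Fin n → k) → Submodule k S :=
          ![fun y => V ⊔ linMul ℓ P (d + 1) (T₁ y), fun y => V ⊔ linMul ℓ P (d + 1) (T₂ y),
            fun y => V ⊔ (linMul ℓ P d (T₁ y)).map (LinearMap.mulLeft k (ℓ (T₂ y))),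
            fun y => V ⊔ linMul ℓ P (d + 1) (T₁ y) ⊔ linMul ℓ P (d + 1) (T₂ y)]
        have hD : ∀ i, IsPolyFamily (D i) := by
          intro i
          fin_cases i
          · exact hVc.sup (isPolyFamily_linMul T₁ _)
          · exact hVc.sup (isPolyFamily_linMul T₂ _)
          · exact hVc.sup ((isPolyFamily_linMul T₁ _).linear_mul (ℓ ∘ₗ T₂))
          · exact (hVc.sup (isPolyFamily_linMul T₁ _)).sup (isPolyFamily_linMul T₂ _)
        have hle : ∀ i y, D i y ≤ P (d + 1) := by
          intro i y
          fin_cases i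
          · exact sup_le hV (linMul_le hmul _ _)
          · exact sup_le hV (linMul_le hmul _ _)
          · refine sup_le hV ?_
            rintro _ ⟨p, hp, rfl⟩
            exact hmul _ _ _ (linMul_le hmul _ _ hp)
          · exact sup_le (sup_le hV (linMul_le hmul _ _)) (linMul_le hmul _ _)
        have hfd : ∀ i y, FiniteDimensional k (D i y) :=
          fun i y => Submodule.finiteDimensional_of_le (hle i y)
        obtain ⟨y, hy⟩ := exists_forall_isMax (fun i => (hD i).isZariskiLSC)
          (fun i y => Submodule.finrank_mono (hle i y))
        have hT₁ : ∀ u v : Fin n → k, T₁ (Sum.elim u v) = u := fun u v => rfl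
        have hT₂ : ∀ u v : Fin n → k, T₂ (Sum.elim u v) = v := fun u v => rfl
        exact ⟨T₁ y, T₂ y, fun g' => hy 0 (Sum.elim g' 0), fun h' => hy 1 (Sum.elim 0 h'),
          fun g' => hy 2 (Sum.elim g' (T₂ y)), fun h' => hy 3 (Sum.elim (T₁ y) h')⟩
      refine (Nat.sub_le_sub_left (hh₀ g) _).trans ?_
      have hV₁ : V ⊔ linMul ℓ P (d + 1) g ≤ P (d + 1) := sup_le hV (linMul_le hmul _ _)
      by_cases hgG : g ∈ G
      · have hV₁' : V ⊔ linMul ℓ P (d + 1) g = V := sup_eq_left.2 (hGV g hgG)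
        -- If a maximizing `g` adds nothing to `V`, no linear form does, so `V` is everything.
        have hfull : P (d + 1) ≤ V := hgen d V fun a p hp => by
          have h1 := hg a
          rw [hV₁'] at h1
          have h2 := Submodule.eq_of_le_of_finrank_le le_sup_left h1
          rw [h2]
          exact Submodule.mem_sup_right ⟨p, hp, rfl⟩
        have := Submodule.finrank_mono hfull
        rw [hV₁']
        omega
      · set V₁ := V ⊔ linMul ℓ P (d + 1) g with hV₁def
        have hc : finrank k V ≤ finrank k V₁ := Submodule.finrank_mono le_sup_left
        have hD₁ := Submodule.finrank_mono hV₁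
        -- the bound on the hyperplane defined by `g`
        have hb₁ := ihB V₁ (G ⊔ Submodule.span k {g}) hV₁
          (by rw [finrank_sup_span_singleton hgG]; omega) (by
            intro a ha
            obtain ⟨x, hx, z, hz, rfl⟩ := Submodule.mem_sup.1 ha
            obtain ⟨t, rfl⟩ := Submodule.mem_span_singleton.1 hz
            rintro _ ⟨p, hp, rfl⟩
            rw [LinearMap.mulLeft_apply, map_add, add_mul]
            refine Submodule.add_mem_sup (hGV x hx ⟨p, hp, rfl⟩) ?_
            rw [map_smul, smul_mul_assoc]
            exact Submodule.smul_mem _ _ ⟨p, hp, rfl⟩) h hmax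
        -- the bound for the colon space
        set K := colonIn V (P d) (ℓ h) with hK
        have hKP : K ≤ P d := inf_le_left
        have hKfd : FiniteDimensional k K := Submodule.finiteDimensional_of_le hKP
        -- This converts the maximality of `g` for `V + h g P_{d-1}` into maximality for `K + g
        -- P_{d-1}`, as the induction on degree requires.
        have hKg : ∀ g', finrank k (K ⊔ linMul ℓ P d g' : Submodule k S) + finrank k V = finrank k
            (V ⊔ (linMul ℓ P d g').map (LinearMap.mulLeft k (ℓ h)) : Submodule k S) +
              finrank k K := by
          intro g'
          have h1 := finrank_sup_map_add V (K ⊔ linMul ℓ P d g') (ℓ h)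
          have h2 : colonIn V (K ⊔ linMul ℓ P d g') (ℓ h) = K := by
            apply le_antisymm
            · exact inf_le_inf_right _ (sup_le hKP (linMul_le hmul _ _))
            · exact le_inf le_sup_left inf_le_right
          have h3 : V ⊔ (K ⊔ linMul ℓ P d g').map (LinearMap.mulLeft k (ℓ h)) =
              V ⊔ (linMul ℓ P d g').map (LinearMap.mulLeft k (ℓ h)) := by
            have h4 : K.map (LinearMap.mulLeft k (ℓ h)) ≤ V :=
              Submodule.map_le_iff_le_comap.2 inf_le_right
            rw [Submodule.map_sup, ← sup_assoc, sup_eq_left.2 h4]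
          rw [h2, h3] at h1
          omega
        have hb₂ := ihd (B + 1) K G hKP hG
          (fun a ha p hp => ⟨linMul_le hmul _ _ hp, hGV a ha (mul_linMul hmul d a h hp)⟩) g
          (fun g' => by
            have h1 := hKg g
            have h2 := hKg g'
            have h3 := hgh g'
            omega)
        have hKh : finrank k (V ⊔ linMul ℓ P (d + 1) h : Submodule k S) + finrank k K =
            finrank k V + finrank k (P d) := finrank_sup_map_add V (P d) (ℓ h)
        have hK₁ : finrank k (V₁ ⊔ linMul ℓ P (d + 1) h : Submodule k S) +
            finrank k (colonIn V₁ (P d) (ℓ h)) = finrank k V₁ + finrank k (P d) :=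
          finrank_sup_map_add V₁ (P d) (ℓ h)
        have hK₁fd : FiniteDimensional k (colonIn V₁ (P d) (ℓ h)) :=
          Submodule.finiteDimensional_of_le inf_le_left
        have hKK : finrank k (K ⊔ linMul ℓ P d g : Submodule k S) ≤
            finrank k (colonIn V₁ (P d) (ℓ h)) := by
          refine Submodule.finrank_mono (sup_le ?_ ?_)
          · exact inf_le_inf_left _ (Submodule.comap_mono le_sup_left)
          · exact fun p hp => ⟨linMul_le hmul _ _ hp,
              (le_sup_right : _ ≤ V₁) (mul_linMul hmul d g h hp)⟩
        have heq := le_antisymm (hg h) (hh g)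
        have hKle := Submodule.finrank_mono hKP
        refine le_greenPer_of_le_add (by omega) ?_
        have harg : finrank k (P (d + 1)) - finrank k V - (finrank k (P (d + 1)) - finrank k V₁) =
            finrank k (P d) - finrank k K := by
          omega
        rw [harg]
        omega

end Bound

/-! ### Existence of a coefficient field -/

section CoefficientField

-- Since the image of `a` lies outside that of `L`, `X ^ p - c` is irreducible. A `q` not divisible
-- by it would be coprime to it, and evaluating a Bézout relation in `k` would give `1 = 0`. This
-- lets `a` be adjoined to a subfield without meeting the kernel.
open Polynomial in
lemma eval₂_eq_zero_of_map_eq_zero {L A k : Type*} [Field L] [CommRing A] [Field k] {p : ℕ}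
    [Fact p.Prime] [CharP k p] (j : L →+* A) (π : A →+* k) {c : L} {a : A} (hac : a ^ p = j c)
    (ha : ∀ l, π (j l) ≠ π a) (q : L[X]) (hq : π (q.eval₂ j a) = 0) : q.eval₂ j a = 0 := by
  have hp : p.Prime := Fact.out
  have hirr : Irreducible (Polynomial.X ^ p - Polynomial.C c : L[X]) := by
    refine X_pow_sub_C_irreducible_of_prime hp fun b hb => ha b ?_
    apply frobenius_inj k p
    simp only [frobenius_def]
    rw [← map_pow, ← map_pow, hb, ← hac, map_pow]
  have hzero : (Polynomial.X ^ p - Polynomial.C c : L[X]).eval₂ j a = 0 := by simp [hac]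
  by_cases hd : (Polynomial.X ^ p - Polynomial.C c : L[X]) ∣ q
  · obtain ⟨r, rfl⟩ := hd
    rw [Polynomial.eval₂_mul, hzero, zero_mul]
  · obtain ⟨u, v, huv⟩ := (hirr.coprime_iff_not_dvd).2 hd
    have h1 := congrArg (fun r => π (eval₂ j a r)) huv
    simp only [Polynomial.eval₂_add, Polynomial.eval₂_mul, hzero, mul_zero, zero_add, map_mul, hq, Polynomial.eval₂_one,
      map_one] at h1
    exact (zero_ne_one h1).elim

/-- A surjection onto a field of characteristic `p` whose kernel is killed by the Frobenius has
a section. -/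
lemma exists_section_of_pow_eq_zero {A k : Type*} [CommRing A] [Field k] (p : ℕ) [Fact p.Prime]
    (hpA : (p : A) = 0) (π : A →+* k) (hπ : Function.Surjective π)
    (hker : ∀ x, π x = 0 → x ^ p = 0) : ∃ s : k →+* A, π.comp s = RingHom.id k := by
  have hp : p.Prime := Fact.out
  have : Nontrivial A := π.domain_nontrivial
  have hAp : CharP A p := (CharP.charP_iff_prime_eq_zero hp).2 hpA
  have hkp : CharP k p := (CharP.charP_iff_prime_eq_zero hp).2 (by
    rw [← map_natCast π, hpA, map_zero])
  -- Containing all `p`-th powers makes `M` a field, with inverses built from `p`-th powers of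
  -- lifts, and keeps every `a` algebraic of degree at most `p` over it.
  obtain ⟨M, -, ⟨hMp, hM0⟩, hmax⟩ := zorn_le_nonempty₀
    {T : Subring A | (∀ x : A, x ^ p ∈ T) ∧ ∀ x ∈ T, π x = 0 → x = 0}
    (fun c hc hchain T hT => ⟨sSup c,
      ⟨fun x => (le_sSup hT : T ≤ sSup c) ((hc hT).1 x), fun x hx hx0 => by
        obtain ⟨S, hS, hxS⟩ := (Subring.mem_sSup_of_directedOn ⟨T, hT⟩ hchain.directedOn).1 hx
        exact (hc hS).2 x hxS hx0⟩, fun z hz => le_sSup hz⟩)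
    (frobenius A p).range ⟨fun x => ⟨x, rfl⟩, by
      rintro _ ⟨x, rfl⟩ hx
      rw [frobenius_def, map_pow] at hx
      exact hker x (eq_zero_of_pow_eq_zero hx)⟩
  have hfield : IsField M := by
    refine ⟨⟨0, 1, zero_ne_one⟩, mul_comm, fun {s} hs => ?_⟩
    have hs0 : π s ≠ 0 := fun h => hs (Subtype.ext (hM0 _ s.2 h))
    obtain ⟨y, hy⟩ := hπ (π s)⁻¹
    have h1 : ((s : A) * y - 1) ^ p = 0 := hker _ (by
      rw [map_sub, map_mul, hy, mul_inv_cancel₀ hs0, map_one, sub_self])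
    rw [sub_pow_char, one_pow, sub_eq_zero, mul_pow] at h1
    refine ⟨s ^ (p - 1) * ⟨y ^ p, hMp y⟩, Subtype.ext ?_⟩
    push_cast
    rw [← mul_assoc, mul_pow_sub_one hp.ne_zero, h1]
  have hsurj : ∀ a, ∃ m ∈ M, π m = a := by
    intro a
    by_contra! ha
    obtain ⟨a, rfl⟩ := hπ a
    let _ := hfield.toField
    let ev : Polynomial M →+* A := Polynomial.eval₂RingHom M.subtype a
    have hle : M ≤ ev.range := fun m hm => ⟨Polynomial.C ⟨m, hm⟩, by simp [ev]⟩
    have hmem : a ∈ ev.range := ⟨Polynomial.X, by simp [ev]⟩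
    refine ha a (hmax (y := ev.range) ⟨fun x => hle (hMp x), ?_⟩ hle hmem) rfl
    rintro _ ⟨q, rfl⟩ hq
    exact eval₂_eq_zero_of_map_eq_zero (p := p) (c := ⟨a ^ p, hMp a⟩) M.subtype π rfl
      (fun l => ha l l.2) q hq
  let e : M ≃+* k := RingEquiv.ofBijective (π.comp M.subtype)
    ⟨(injective_iff_map_eq_zero _).2 fun x hx => Subtype.ext (hM0 x x.2 hx),
      fun a => let ⟨m, hm, h⟩ := hsurj a; ⟨⟨m, hm⟩, h⟩⟩
  exact ⟨M.subtype.comp e.symm, RingHom.ext fun a => e.apply_symm_apply a⟩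

/-- A surjection with nilpotent kernel onto a field of characteristic `p` has a section. -/
lemma exists_section_of_ker_pow_eq_bot {k : Type*} [Field k] (p : ℕ) [Fact p.Prime] (n : ℕ) :
    ∀ {A : Type*} [CommRing A], (p : A) = 0 → ∀ π : A →+* k, Function.Surjective π →
      RingHom.ker π ^ n = ⊥ → ∃ s : k →+* A, π.comp s = RingHom.id k := by
  induction n with
  | zero =>
    intro A _ _ π _ h
    rw [pow_zero, Ideal.one_eq_top] at h
    have h1 : (1 : A) ∈ (⊥ : Ideal A) := h ▸ Submodule.mem_top
    have := π.domain_nontrivial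
    exact (one_ne_zero ((Submodule.mem_bot A).1 h1)).elim
  | succ n ih =>
    intro A _ hpA π hπ h
    have hp : p.Prime := Fact.out
    rcases Nat.eq_zero_or_pos n with rfl | hn
    · refine exists_section_of_pow_eq_zero p hpA π hπ fun x hx => ?_
      rw [zero_add, pow_one] at h
      have hx' : x ∈ (⊥ : Ideal A) := h ▸ (hx : x ∈ RingHom.ker π)
      rw [(Submodule.mem_bot A).1 hx', zero_pow hp.ne_zero]
    let I := RingHom.ker π ^ n
    have hI : I ≤ RingHom.ker π := Ideal.pow_le_self (by omega)
    let π' : A ⧸ I →+* k := Ideal.Quotient.lift I π hI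
    have hker : RingHom.ker π' = (RingHom.ker π).map (Ideal.Quotient.mk I) :=
      Ideal.ker_quotient_lift π hI
    obtain ⟨s, hs⟩ := ih (A := A ⧸ I) (by rw [← map_natCast (Ideal.Quotient.mk I), hpA, map_zero])
      π' (fun a => let ⟨x, hx⟩ := hπ a; ⟨Ideal.Quotient.mk I x, hx⟩)
      (by rw [hker, ← Ideal.map_pow, Ideal.map_quotient_self])
    have hs' : ∀ a, π' (s a) = a := fun a => RingHom.congr_fun hs a
    -- The kernel of `T → k` lies in `I`, whose elements square to zero because `2n ≥ n + 1`; hence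
    -- Frobenius kills it.
    let T : Subring A := s.range.comap (Ideal.Quotient.mk I)
    obtain ⟨t, ht⟩ := exists_section_of_pow_eq_zero (A := T) p (Subtype.ext (by simpa using hpA))
      (π.comp T.subtype) (fun a => by
        obtain ⟨y, hy⟩ := Ideal.Quotient.mk_surjective (s a)
        refine ⟨⟨y, ⟨a, hy.symm⟩⟩, ?_⟩
        have := hs' a
        rw [← hy] at this
        exact this) (by
        rintro ⟨x, a, ha⟩ hx
        have hx' : π x = 0 := hx
        have ha0 : a = 0 := by
          rw [← hs' a, ha]
          exact hx'
        rw [ha0, map_zero] at ha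
        have hxI : x ∈ RingHom.ker π ^ n := Ideal.Quotient.eq_zero_iff_mem.1 ha.symm
        have h2 : x ^ 2 ∈ RingHom.ker π ^ (n + 1) := by
          refine Ideal.pow_le_pow_right (show n + 1 ≤ n * 2 by omega) ?_
          rw [pow_mul]
          exact Ideal.pow_mem_pow hxI 2
        rw [h, Submodule.mem_bot] at h2
        refine Subtype.ext ?_
        exact pow_eq_zero_of_le hp.two_le h2)
    exact ⟨T.subtype.comp t, ht⟩

/-- A surjection with nilpotent kernel from a `ℚ`-algebra onto a field has a section. -/
lemma exists_section_of_algebraRat {A k : Type*} [CommRing A] [Field k] [Algebra ℚ A] [CharZero k]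
    (π : A →+* k) (hπ : Function.Surjective π) (hker : IsNilpotent (RingHom.ker π)) :
    ∃ s : k →+* A, π.comp s = RingHom.id k := by
  obtain ⟨ι, v, hv⟩ := exists_isTranscendenceBasis' ℚ k
  have := hv.isAlgebraic_field
  have : Algebra.FormallySmooth ℚ k :=
    Algebra.FormallySmooth.of_algebraicIndependent_of_isSeparable hv.1
  refine ⟨(Algebra.FormallySmooth.liftOfSurjective (AlgHom.id ℚ k) π.toRatAlgHom hπ hker).toRingHom,
    RingHom.ext fun x => ?_⟩
  exact Algebra.FormallySmooth.liftOfSurjective_apply (AlgHom.id ℚ k) π.toRatAlgHom hπ hker x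

/-- **Cohen's theorem** for Artinian rings. -/
theorem exists_isCoefficientField {R₀ : Type*} [CommRing R₀] [IsLocalRing R₀] [IsArtinianRing R₀]
    (h : IsEquicharacteristic R₀) : ∃ ι : ResidueField R₀ →+* R₀, IsCoefficientField ι := by
  have hnil : IsNilpotent (RingHom.ker (residue R₀)) := by
    rw [IsLocalRing.ker_residue]
    exact (isArtinianRing_iff_isNilpotent_maximalIdeal R₀).1 inferInstance
  have hsurj := residue_surjective (R := R₀)
  rcases CharP.char_is_prime_or_zero (ResidueField R₀) (ringChar (ResidueField R₀)) with hp | h0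
  · have := Fact.mk hp
    obtain ⟨n, hn⟩ := hnil
    refine exists_section_of_ker_pow_eq_bot (ringChar (ResidueField R₀)) n ?_ _ hsurj hn
    rw [← show ringChar R₀ = ringChar (ResidueField R₀) from h]
    exact CharP.cast_eq_zero R₀ _
  · have : CharP (ResidueField R₀) 0 := h0 ▸ ringChar.charP _
    have : CharZero (ResidueField R₀) := CharP.charP_to_charZero _
    -- Every proper quotient maps to the residue field, so it has characteristic 0.
    obtain ⟨_⟩ := (EqualCharZero.nonempty_algebraRat_iff R₀).2 fun (I : Ideal R₀) hI =>
      (Ideal.Quotient.lift I (residue R₀) fun x hx =>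
        (residue_eq_zero_iff x).2 (le_maximalIdeal hI hx)).charZero
    exact exists_section_of_algebraRat _ hsurj hnil

end CoefficientField

/-! ### Length versus dimension, and lengths of quotients -/

section Length

variable {K R : Type*} [Field K] [CommRing R] [IsLocalRing R] [Algebra K R]

/-- The maximal ideal kills a simple module, so scalars from `K` already give all multiples of a
generator. -/
lemma finrank_eq_one_of_isSimpleModule
    (hK : Function.Surjective ((residue R).comp (algebraMap K R))) {M : Type*} [AddCommGroup M]
    [Module R M] [Module K M] [IsScalarTower K R M] [IsSimpleModule R M] : finrank K M = 1 := by
  have := IsSimpleModule.nontrivial R M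
  obtain ⟨x, hx⟩ := exists_ne (0 : M)
  refine finrank_eq_one x hx fun y => ?_
  obtain ⟨r, rfl⟩ := IsSimpleModule.toSpanSingleton_surjective R hx y
  obtain ⟨c, hc⟩ := hK (residue R r)
  refine ⟨c, ?_⟩
  have hmem : algebraMap K R c - r ∈ maximalIdeal R := by
    rw [← residue_eq_zero_iff, map_sub, sub_eq_zero]
    exact hc
  have hann : Module.annihilator R M = maximalIdeal R :=
    eq_maximalIdeal IsSimpleModule.annihilator_isMaximal
  rw [← hann] at hmem
  have h0 := Module.mem_annihilator.1 hmem x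
  rw [sub_smul, sub_eq_zero, algebraMap_smul] at h0
  exact h0

lemma length_eq_length_of_isFiniteLength
    (hK : Function.Surjective ((residue R).comp (algebraMap K R))) {M : Type*} [AddCommGroup M]
    [Module R M] (hM : IsFiniteLength R M) : ∀ [Module K M] [IsScalarTower K R M],
    Module.length R M = Module.length K M := by
  induction hM with
  | of_subsingleton =>
    intro _ _
    rw [Module.length_eq_zero, Module.length_eq_zero]
  | @of_simple_quotient M _ _ N _ _ ih =>
    intro _ _
    have h1 := Module.length_eq_add_of_exact N.subtype N.mkQ N.subtype_injective
      N.mkQ_surjective (LinearMap.exact_subtype_mkQ N)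
    have h2 := Module.length_eq_add_of_exact (N.subtype.restrictScalars K)
      (N.mkQ.restrictScalars K) N.subtype_injective N.mkQ_surjective
      (LinearMap.exact_subtype_mkQ N)
    have h3 := finrank_eq_one_of_isSimpleModule hK (M := M ⧸ N)
    have : Module.Finite K (M ⧸ N) := Module.finite_of_finrank_pos (by omega)
    rw [h1, h2, ih, Module.length_eq_one R (M ⧸ N), Module.length_eq_finrank K (M ⧸ N), h3,
      Nat.cast_one]

end Length

section QuotLength

variable {R : Type*} [CommRing R]

lemma quotLength_add_length {E : Type*} [AddCommGroup E] [Module R E] {M N : Submodule R E}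
    (h : N ≤ M) : quotLength M N + Module.length R N = Module.length R M := by
  rw [Module.length_eq_add_of_exact (N.submoduleOf M).subtype (N.submoduleOf M).mkQ
    (Submodule.subtype_injective _) (Submodule.mkQ_surjective _)
    (LinearMap.exact_subtype_mkQ _), add_comm, (Submodule.submoduleOfEquivOfLe h).length_eq]
  rfl

lemma quotLength_map_le {E F : Type*} [AddCommGroup E] [Module R E] [AddCommGroup F] [Module R F]
    (f : E →ₗ[R] F) {M N : Submodule R E} :
    quotLength (M.map f) (N.map f) ≤ quotLength M N := by
  let g : (M ⧸ N.submoduleOf M) →ₗ[R] (M.map f ⧸ (N.map f).submoduleOf (M.map f)) :=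
    Submodule.mapQ _ _ (f.submoduleMap M) fun x hx => ⟨x, hx, rfl⟩
  refine Module.length_le_of_surjective g fun y => ?_
  obtain ⟨⟨_, x, hx, rfl⟩, rfl⟩ := Submodule.mkQ_surjective _ y
  exact ⟨Submodule.Quotient.mk ⟨x, hx⟩, rfl⟩

end QuotLength

/-! ### Application to the polynomial ring -/

section Polynomial

variable {R₀ : Type*} [CommRing R₀] {b : ℕ}

lemma addMul_le {d : ℕ} {V : Submodule R₀ (MvPolynomial (Fin b) R₀)} (hV : V ≤ Rdeg R₀ b (d + 1))
    {h : MvPolynomial (Fin b) R₀} (hh : h.IsHomogeneous 1) :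
    addMul (d + 1) V h ≤ Rdeg R₀ b (d + 1) := by
  refine sup_le hV ?_
  rintro _ ⟨p, hp, rfl⟩
  have := hh.mul ((mem_homogeneousSubmodule d p).1 hp)
  rwa [add_comm] at this

lemma Rdeg_succ_le {d : ℕ} {V : AddSubgroup (MvPolynomial (Fin b) R₀)}
    (hV : ∀ i, ∀ p ∈ Rdeg R₀ b d, X i * p ∈ V) {q : MvPolynomial (Fin b) R₀}
    (hq : q ∈ Rdeg R₀ b (d + 1)) : q ∈ V := by
  rw [q.as_sum]
  refine sum_mem fun m hm => ?_
  have hdeg : m.degree = d + 1 := by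
    by_contra hne
    exact (mem_support_iff.1 hm) (((mem_homogeneousSubmodule _ q).1 hq).coeff_eq_zero hne)
  obtain ⟨i, hi⟩ : ∃ i, m i ≠ 0 := by
    by_contra! h0
    have : m = 0 := Finsupp.ext h0
    rw [this] at hdeg
    simp at hdeg
  have hle : Finsupp.single i 1 ≤ m := Finsupp.single_le_iff.2 (by omega)
  have hdec : Finsupp.single i 1 + (m - Finsupp.single i 1) = m := add_tsub_cancel_of_le hle
  have hmon : monomial m (coeff m q) = X i * monomial (m - Finsupp.single i 1) (coeff m q) := by
    rw [X, monomial_mul, one_mul, hdec]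
  rw [hmon]
  refine hV i _ ((mem_homogeneousSubmodule _ _).2 (isHomogeneous_monomial _ ?_))
  have := congrArg Finsupp.degree hdec
  rw [map_add, Finsupp.degree_single, hdeg] at this
  omega

lemma linForm_isHomogeneous [IsLocalRing R₀] (ι : ResidueField R₀ →+* R₀)
    (a : Fin b → ResidueField R₀) : (linForm ι a).IsHomogeneous 1 :=
  IsHomogeneous.sum _ _ _ fun i _ => by
    simpa using (isHomogeneous_C (Fin b) (ι (a i))).mul (isHomogeneous_X R₀ i)

variable [IsLocalRing R₀]

/-- The parametrization of the linear forms with coefficients in the coefficient field, as a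
linear map over the coefficient field. -/
lemma exists_linForm_linearMap [Algebra (ResidueField R₀) R₀] (ι : ResidueField R₀ →+* R₀)
    (hι : algebraMap (ResidueField R₀) R₀ = ι) :
    ∃ ℓ : (Fin b → ResidueField R₀) →ₗ[ResidueField R₀] MvPolynomial (Fin b) R₀,
      ∀ a, ℓ a = linForm ι a := by
  refine ⟨Fintype.linearCombination (ResidueField R₀) X, fun a => ?_⟩
  rw [Fintype.linearCombination_apply]
  refine Finset.sum_congr rfl fun i _ => ?_
  rw [← hι, ← smul_eq_C_mul, algebraMap_smul]

theorem green_restriction [IsArtinianRing R₀] [Infinite (ResidueField R₀)]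
    {ι : ResidueField R₀ →+* R₀} (hι : IsCoefficientField ι) (B d : ℕ)
    {V : Submodule R₀ (MvPolynomial (Fin (B + 1)) R₀)} (hV : V ≤ Rdeg R₀ (B + 1) (d + 1)) :
    IsZariskiOpen (goodForms ι (d + 1) V) ∧ ∀ a ∈ goodForms ι (d + 1) V, ∀ c : ℕ,
      quotLength (Rdeg R₀ (B + 1) (d + 1)) V = c →
      quotLength (Rdeg R₀ (B + 1) (d + 1)) (addMul (d + 1) V (linForm ι a)) ≤
        greenPer B (d + 1) c := by
  let _ : Algebra (ResidueField R₀) R₀ := ι.toAlgebra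
  have hK : Function.Surjective ((residue R₀).comp (algebraMap (ResidueField R₀) R₀)) :=
    fun x => ⟨x, RingHom.congr_fun hι x⟩
  obtain ⟨ℓ, hℓ⟩ := exists_linForm_linearMap (b := B + 1) ι rfl
  let P : ℕ → Submodule (ResidueField R₀) (MvPolynomial (Fin (B + 1)) R₀) :=
    fun i => (Rdeg R₀ (B + 1) i).restrictScalars (ResidueField R₀)
  have hfinR : ∀ i, Module.Finite R₀ (Rdeg R₀ (B + 1) i) := fun i =>
    Module.Finite.iff_fg.2 (homogeneousSubmodule_fg _ _ i)
  -- `R₀` has finite length over itself, hence finite dimension over its coefficient field.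
  have hfinK : Module.Finite (ResidueField R₀) R₀ := by
    have h := length_eq_length_of_isFiniteLength hK ((isArtinianRing_iff_isFiniteLength R₀).1 ‹_›)
    have := Module.length_ne_top_iff.1 (h ▸ Module.length_ne_top (R := R₀) (M := R₀))
    have := (isFiniteLength_iff_isNoetherian_isArtinian.1 this).1
    infer_instance
  have hfin : ∀ i, FiniteDimensional (ResidueField R₀) (P i) := by
    intro i
    have : IsScalarTower (ResidueField R₀) R₀ (P i) :=
      ⟨fun x y z => Subtype.ext (smul_assoc x y (z : MvPolynomial (Fin (B + 1)) R₀))⟩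
    have : Module.Finite R₀ (P i) := hfinR i
    exact Module.Finite.trans R₀ (P i)
  have hmul : ∀ i a, ∀ p ∈ P i, ℓ a * p ∈ P (i + 1) := by
    intro i a p hp
    have := (linForm_isHomogeneous ι a).mul ((mem_homogeneousSubmodule i p).1 hp)
    rw [add_comm 1 i] at this
    rw [hℓ]
    exact this
  have hgen : ∀ i (W : Submodule (ResidueField R₀) (MvPolynomial (Fin (B + 1)) R₀)),
      (∀ a, ∀ p ∈ P i, ℓ a * p ∈ W) → P (i + 1) ≤ W := by
    intro i W hW q hq
    refine Rdeg_succ_le (V := W.toAddSubgroup) (fun j p hp => ?_) hq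
    have := hW (Pi.single j 1) p hp
    rw [hℓ] at this
    simpa [linForm, Pi.single_apply, Finset.sum_ite_eq, apply_ite, ite_mul] using this
  have hlen : ∀ (N : Submodule R₀ (MvPolynomial (Fin (B + 1)) R₀)), N ≤ Rdeg R₀ (B + 1) (d + 1) →
      Module.length R₀ N = finrank (ResidueField R₀) (N.restrictScalars (ResidueField R₀)) := by
    intro N hN
    have hfl : IsFiniteLength R₀ (Rdeg R₀ (B + 1) (d + 1)) :=
      isFiniteLength_iff_isNoetherian_isArtinian.2 ⟨inferInstance, inferInstance⟩
    have hNfd : FiniteDimensional (ResidueField R₀) (N.restrictScalars (ResidueField R₀)) :=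
      Submodule.finiteDimensional_of_le (S₂ := P (d + 1)) hN
    rw [← Module.length_eq_finrank]
    exact length_eq_length_of_isFiniteLength hK
      (hfl.of_injective (Submodule.inclusion_injective hN))
  let V' := V.restrictScalars (ResidueField R₀)
  have hV' : V' ≤ P (d + 1) := hV
  have hadd : ∀ a, (addMul (d + 1) V (linForm ι a)).restrictScalars (ResidueField R₀) =
      V' ⊔ linMul ℓ P (d + 1) a := by
    intro a
    ext x
    rw [Submodule.restrictScalars_mem, addMul, Submodule.mem_sup, Submodule.mem_sup, linMul]
    simp only [Submodule.mem_map, LinearMap.mulLeft_apply, hℓ]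
    rfl
  have hleW : ∀ a, addMul (d + 1) V (linForm ι a) ≤ Rdeg R₀ (B + 1) (d + 1) := fun a =>
    addMul_le hV (linForm_isHomogeneous ι a)
  have hlenadd : ∀ a, Module.length R₀ (addMul (d + 1) V (linForm ι a)) =
      finrank (ResidueField R₀)
        (V' ⊔ linMul ℓ P (d + 1) a : Submodule _ (MvPolynomial (Fin (B + 1)) R₀)) := by
    intro a
    rw [hlen _ (hleW a), hadd]
  have hgood : goodForms ι (d + 1) V = {a | ∀ a', finrank (ResidueField R₀)
      (V' ⊔ linMul ℓ P (d + 1) a' : Submodule _ (MvPolynomial (Fin (B + 1)) R₀)) ≤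
      finrank (ResidueField R₀)
        (V' ⊔ linMul ℓ P (d + 1) a : Submodule _ (MvPolynomial (Fin (B + 1)) R₀))} := by
    ext a
    simp only [goodForms, Set.mem_ofPred_eq, hlenadd, Nat.cast_le]
  have hV'fd : FiniteDimensional (ResidueField R₀) V' := Submodule.finiteDimensional_of_le hV'
  refine ⟨?_, fun a ha c hc => ?_⟩
  · rw [hgood]
    exact ((isPolySection_const_family V').sup
      (isPolyFamily_linMul LinearMap.id (d + 1))).isZariskiLSC.isZariskiOpen
  · rw [hgood] at ha
    -- With `G = ⊥`, all `B + 1` variables are effective.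
    have hbound := finrank_sub_finrank_sup_linMul_le hmul hgen (d + 1) B V' ⊥ hV'
      (by rw [finrank_bot]; omega) (by
        intro g hg
        rw [(Submodule.mem_bot _).1 hg]
        rintro _ ⟨p, -, rfl⟩
        rw [LinearMap.mulLeft_apply, map_zero, zero_mul]
        exact zero_mem _) a ha
    have h1 := quotLength_add_length hV
    have h2 := quotLength_add_length (hleW a)
    have h3 : Module.length R₀ (Rdeg R₀ (B + 1) (d + 1)) = finrank (ResidueField R₀) (P (d + 1)) :=
      hlen _ le_rfl
    rw [hc, hlen V hV, h3] at h1
    rw [hlenadd, h3] at h2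
    have h1' : c + finrank (ResidueField R₀) V' = finrank (ResidueField R₀) (P (d + 1)) := by
      exact_mod_cast h1
    rw [← h1', Nat.add_sub_cancel, h1'] at hbound
    obtain ⟨m, hm⟩ := ENat.ne_top_iff_exists.1 (fun h : quotLength (Rdeg R₀ (B + 1) (d + 1))
      (addMul (d + 1) V (linForm ι a)) = ⊤ => by
        rw [h, top_add] at h2
        exact ENat.top_ne_natCast _ h2)
    rw [← hm] at h2 ⊢
    norm_cast at h2 ⊢
    omega

end Polynomial

lemma monoms_eq_choose (B d : ℕ) : monoms B d = (d + B).choose B := by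
  rw [monoms, add_comm B d, Nat.choose_symm_add]

lemma restrMonoms_eq_binom (B d : ℕ) :
    restrMonoms B (d + 1) = binom (d + 1 + (B + 1) - 2) ((B + 1 : ℕ) - 2 : ℤ) := by
  unfold binom
  cases B with
  | zero => simp [restrMonoms]
  | succ B =>
    rw [if_pos (by push_cast; omega), restrMonoms_succ, monoms_eq_choose]
    congr 1
    push_cast
    omega

end GreenRestriction

theorem theorem2p2 {R₀ : Type*} [CommRing R₀] [IsLocalRing R₀] [IsArtinianRing R₀]
    (hR₀ : GreenRestriction.IsEquicharacteristic R₀)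
    [Infinite (IsLocalRing.ResidueField R₀)]
    (b d : ℕ) (hb : 1 ≤ b) (hd : 1 ≤ d) :
    (∃ ι : IsLocalRing.ResidueField R₀ →+* R₀, GreenRestriction.IsCoefficientField ι) ∧
    ∀ ι : IsLocalRing.ResidueField R₀ →+* R₀, GreenRestriction.IsCoefficientField ι →
    ∀ V : Submodule R₀ (MvPolynomial (Fin b) R₀), V ≤ GreenRestriction.Rdeg R₀ b d →
      GreenRestriction.IsZariskiOpen (GreenRestriction.goodForms ι d V) ∧
      ∀ a ∈ GreenRestriction.goodForms ι d V, ∀ q r : ℕ,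
        GreenRestriction.quotLength (GreenRestriction.Rdeg R₀ b d) V =
            (((d + b - 1).choose (b - 1) * q + r : ℕ) : ℕ∞) →
        r < (d + b - 1).choose (b - 1) →
        GreenRestriction.quotLength
            (GreenRestriction.quotDeg d (GreenRestriction.linForm ι a))
            (GreenRestriction.quotSub d V (GreenRestriction.linForm ι a)) ≤
          ((GreenRestriction.binom (d + b - 2) ((b : ℤ) - 2) * q +
            GreenRestriction.lowerMinus d r : ℕ) : ℕ∞) := by
  refine ⟨GreenRestriction.exists_isCoefficientField hR₀, fun ι hι V hV => ?_⟩
  obtain ⟨B, rfl⟩ := Nat.exists_eq_succ_of_ne_zero (Nat.one_le_iff_ne_zero.1 hb)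
  obtain ⟨d, rfl⟩ := Nat.exists_eq_succ_of_ne_zero (Nat.one_le_iff_ne_zero.1 hd)
  obtain ⟨hopen, hbound⟩ := GreenRestriction.green_restriction hι B d hV
  refine ⟨hopen, fun a ha q r hc hr => ?_⟩
  have hm : (d.succ + B.succ - 1).choose (B.succ - 1) = GreenRestriction.monoms B (d + 1) :=
    (GreenRestriction.monoms_eq_choose B (d + 1)).symm
  rw [hm] at hc hr
  -- The quotient in `R/(h)` is an image of `R_d/(V + hR_{d-1})`, so an inequality of lengths
  -- suffices.
  refine (GreenRestriction.quotLength_map_le _).trans ((hbound a ha _ hc).trans ?_)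
  rw [GreenRestriction.greenPer_mul_add hr, GreenRestriction.restrMonoms_eq_binom,
    ← GreenRestriction.lowerMinus_eq_green hr]
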